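/- A set operad is a positive set species $\mathcal P$ (a contravariant functor $B\mapsto\mathcal P_B$ from finite sets with bijections to sets, with $\mathcal P_\emptyset=\emptyset$) together with a unit $\mathbf 1\in\mathcal P_{\{*\}}$ and partial compositions $\circ_b:\mathcal P_B\times\mathcal P_C\to\mathcal P_{B\sqcup_b C}$ for $b\in B$, where $B\sqcup_b C=(B\setminus\{b\})\sqcup C$, which are natural in $B$ and $C$, unital, and satisfy the sequential and parallel associativity axioms $$\alpha\circ_b(\beta\circ_c\gamma)=(\alpha\circ_b\beta)\circ_c\gamma,\qquad (\alpha\circ_b\beta)\circ_{b'}\gamma=(\alpha\circ_{b'}\gamma)\circ_b\beta\quad(b\ne b').$$ A corolla structure on a finite set $B$ is a quasi-order on $B$ with exactly one minimum $r$ (the root), such that every element $x\neq r$ is maximal (i.e. $x\le y$ implies $y\le x$). Its branches are the classes, on $B\setminus\{r\}$, of the equivalence relation "$x\le y$ and $y\le x$". Let $\mathbb K_B$ be the set of corolla structures on $B$; bijections act by relabeling. For $\beta\in\mathbb K_B$, $b\in B$ and $\gamma\in\mathbb K_C$ define $\beta\circ_b\gamma\in\mathbb K_{B\sqcup_b C}$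 as follows. If $b$ is the root of $\beta$, then $\beta\circ_b\gamma$ is the corolla whose root is the root of $\gamma$ and whose branches are all the branches of $\beta$ and all the branches of $\gamma$. If $b$ is not the root of $\beta$, then $\beta\circ_b\gamma$ is obtained from $\beta$ by replacing $b$, in its branch, by the whole set $C$. The unit is the unique corolla structure on the one-element set. Let $\mathcal M$ be the magmatic operad: $\mathcal M_B$ is the set of planar binary trees with leaves labeled bijectively by $B$, and $s\circ_b t$ is obtained by plugging $t$ at the leaf $b$ of $s$. Let $\mu\in\mathcal M_{\{1,2\}}$ be the tree with two leaves labeled $1,2$ from left to right. The $\mathrm{NAPNAP}'$ operad is the quotient of $\mathcal M$ by the finest family of equivalence relations on the sets $\mathcal M_B$ which is compatible with relabelings and partial compositions and which identifies $\mu\circ_2\mu$ with $\tau_{12}(\mu\circ_2\mu)$ and $\mu\circ_1\mu$ with $\tau_{12}(\mu\circ_1\mu)$, where $\tau_{12}$ exchanges the labels of the first two leaves; that is, it imposes $x(yz)=y(xz)$ and $(xy)z=(yx)z$. **Theorem.** The species $\mathbb K$, with the unit and the partial compositions above, is a set operad, and it is isomorphic, as a set operad, to the $\mathrm{NAPNAP}'$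 operad. -/

import Mathlib

universe u

/-! ## Set species and set operads (partial compositions) -/

/-- A set species: a contravariant functor from finite sets with bijections to sets.
A bijection `φ : B ≃ C` induces the relabeling `map φ : obj C → obj B`. -/
structure SetSpecies where
  obj : (B : Type u) → [Finite B] → Type u
  map : ∀ {B C : Type u} [Finite B] [Finite C], (B ≃ C) → obj C → obj B
  map_refl : ∀ (B : Type u) [Finite B] (x : obj B), map (Equiv.refl B) x = x
  map_trans : ∀ {B C D : Type u} [Finite B] [Finite C] [Finite D] (φ : B ≃ C) (ψ : C ≃ D)
    (x : obj D), map (φ.trans ψ) x = map φ (map ψ x)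

/-- The set `B ⊔_b C = (B \ {b}) ⊔ C`. -/
abbrev Glue (B : Type u) (b : B) (C : Type u) : Type u := {x : B // x ≠ b} ⊕ C

namespace Glue

/-- The bijection `B ⊔_b C ≃ B' ⊔_{φ b} C'` induced by `φ : B ≃ B'` and `ψ : C ≃ C'`. -/
def congr {B B' C C' : Type u} (φ : B ≃ B') (b : B) (ψ : C ≃ C') :
    Glue B b C ≃ Glue B' (φ b) C' :=
  Equiv.sumCongr (φ.subtypeEquiv fun x => by simp) ψ

/-- The canonical identification `B ⊔_b (C ⊔_c D) = (B ⊔_b C) ⊔_c D`. -/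
def seqEquiv {B C : Type u} (b : B) (c : C) (D : Type u) :
    Glue B b (Glue C c D) ≃ Glue (Glue B b C) (Sum.inr c) D where
  toFun
    | Sum.inl x => Sum.inl ⟨Sum.inl x, by simp⟩
    | Sum.inr (Sum.inl y) => Sum.inl ⟨Sum.inr y.1, fun h => y.2 (Sum.inr_injective h)⟩
    | Sum.inr (Sum.inr d) => Sum.inr d
  invFun
    | Sum.inl ⟨Sum.inl x, _⟩ => Sum.inl x
    | Sum.inl ⟨Sum.inr y, h⟩ => Sum.inr (Sum.inl ⟨y, fun e => h (congrArg Sum.inr e)⟩)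
    | Sum.inr d => Sum.inr (Sum.inr d)
  left_inv := by rintro (x | y | d) <;> rfl
  right_inv := by rintro (⟨x | y, h⟩ | d) <;> rfl

/-- One direction of the canonical identification `(B ⊔_b C) ⊔_{b'} D = (B ⊔_{b'} D) ⊔_b C`. -/
def parFun {B : Type u} (b b' : B) (h : b' ≠ b) (h' : b ≠ b') (C D : Type u) :
    Glue (Glue B b C) (Sum.inl ⟨b', h⟩) D → Glue (Glue B b' D) (Sum.inl ⟨b, h'⟩) C
  | Sum.inl ⟨Sum.inl x, hx⟩ =>
      Sum.inl ⟨Sum.inl ⟨x.1, fun e => hx (congrArg Sum.inl (Subtype.ext e))⟩,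
        fun e => x.2 (congrArg Subtype.val (Sum.inl_injective e))⟩
  | Sum.inl ⟨Sum.inr c, _⟩ => Sum.inr c
  | Sum.inr d => Sum.inl ⟨Sum.inr d, by simp⟩

/-- The canonical identification `(B ⊔_b C) ⊔_{b'} D = (B ⊔_{b'} D) ⊔_b C`, for `b ≠ b'`. -/
def parEquiv {B : Type u} (b b' : B) (h : b' ≠ b) (C D : Type u) :
    Glue (Glue B b C) (Sum.inl ⟨b', h⟩) D ≃ Glue (Glue B b' D) (Sum.inl ⟨b, h.symm⟩) C where
  toFun := parFun b b' h h.symm C D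
  invFun := parFun b' b h.symm h D C
  left_inv := by rintro (⟨x | c, hx⟩ | d) <;> rfl
  right_inv := by rintro (⟨x | c, hx⟩ | d) <;> rfl

/-- The canonical identification `{*} ⊔_* C = C`. -/
def oneLeftEquiv (C : Type u) : Glue PUnit.{u + 1} PUnit.unit C ≃ C where
  toFun
    | Sum.inl x => (x.2 rfl).elim
    | Sum.inr c => c
  invFun := Sum.inr
  left_inv := by
    rintro (x | c)
    · exact (x.2 rfl).elim
    · rfl
  right_inv _ := rfl

open Classical in
/-- The canonical identification `B ⊔_b {*} = B`, where `*` is sent to `b`. -/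
noncomputable def oneRightEquiv {B : Type u} (b : B) : Glue B b PUnit.{u + 1} ≃ B where
  toFun
    | Sum.inl x => x.1
    | Sum.inr _ => b
  invFun x := if h : x = b then Sum.inr PUnit.unit else Sum.inl ⟨x, h⟩
  left_inv := by
    rintro (x | c)
    · simp [x.2]
    · simp
  right_inv x := by
    by_cases h : x = b <;> simp [h]

end Glue

/-- A set species with a distinguished element of arity one and partial compositions
`∘_b : P_B × P_C → P_{B ⊔_b C}`, without any axiom on these operations. -/
structure OperadData extends SetSpecies.{u} where
  one : obj PUnit.{u + 1}
  comp : ∀ {B C : Type u} [Finite B] [Finite C], obj B → (b : B) → obj C → obj (Glue B b C)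

/-- The axioms of a set operad: the species is positive, the partial compositions are natural
under relabeling, and they are associative (sequentially and in parallel) and unital,
up to the canonical identifications of the labeling sets. -/
structure OperadData.IsOperad (P : OperadData.{u}) : Prop where
  positive : ∀ (B : Type u) [Finite B] [IsEmpty B], IsEmpty (P.obj B)
  map_comp : ∀ {B B' C C' : Type u} [Finite B] [Finite B'] [Finite C] [Finite C']
    (φ : B ≃ B') (ψ : C ≃ C') (b : B) (α : P.obj B') (β : P.obj C'),
    P.map (Glue.congr φ b ψ) (P.comp α (φ b) β) = P.comp (P.map φ α) b (P.map ψ β)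
  comp_seq : ∀ {B C D : Type u} [Finite B] [Finite C] [Finite D] (b : B) (c : C)
    (α : P.obj B) (β : P.obj C) (γ : P.obj D),
    P.comp α b (P.comp β c γ) = P.map (Glue.seqEquiv b c D) (P.comp (P.comp α b β) (Sum.inr c) γ)
  comp_par : ∀ {B C D : Type u} [Finite B] [Finite C] [Finite D] (b b' : B) (h : b' ≠ b)
    (α : P.obj B) (β : P.obj C) (γ : P.obj D),
    P.comp (P.comp α b β) (Sum.inl ⟨b', h⟩) γ =
      P.map (Glue.parEquiv b b' h C D) (P.comp (P.comp α b' γ) (Sum.inl ⟨b, h.symm⟩) β)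
  one_comp : ∀ {C : Type u} [Finite C] (α : P.obj C),
    P.comp P.one PUnit.unit α = P.map (Glue.oneLeftEquiv C) α
  comp_one : ∀ {B : Type u} [Finite B] (b : B) (α : P.obj B),
    P.comp α b P.one = P.map (Glue.oneRightEquiv b) α

/-- A set operad. -/
structure SetOperad extends OperadData.{u} where
  isOperad : toOperadData.IsOperad

/-- An isomorphism of set operads. -/
structure SetOperad.Iso (P Q : SetOperad.{u}) where
  equiv : (B : Type u) → [Finite B] → P.obj B ≃ Q.obj B
  map_equiv : ∀ {B C : Type u} [Finite B] [Finite C] (φ : B ≃ C) (α : P.obj C),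
    equiv B (P.map φ α) = Q.map φ (equiv C α)
  equiv_one : equiv PUnit.{u + 1} P.one = Q.one
  equiv_comp : ∀ {B C : Type u} [Finite B] [Finite C] (α : P.obj B) (b : B) (β : P.obj C),
    equiv (Glue B b C) (P.comp α b β) = Q.comp (equiv B α) b (equiv C β)

/-! ## Quotient of a set operad by the congruence generated by relations -/

namespace SetOperad

/-- The finest family of equivalence relations which contains `r` and is compatible with
relabeling and with the partial compositions. -/
inductive CongrGen (P : SetOperad.{u})
    (r : (B : Type u) → [Finite B] → P.obj B → P.obj B → Prop) :
    (B : Type u) → [Finite B] → P.obj B → P.obj B → Prop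
  | of {B : Type u} [Finite B] {x y : P.obj B} : r B x y → CongrGen P r B x y
  | refl {B : Type u} [Finite B] (x : P.obj B) : CongrGen P r B x x
  | symm {B : Type u} [Finite B] {x y : P.obj B} : CongrGen P r B x y → CongrGen P r B y x
  | trans {B : Type u} [Finite B] {x y z : P.obj B} :
      CongrGen P r B x y → CongrGen P r B y z → CongrGen P r B x z
  | map {B C : Type u} [Finite B] [Finite C] (φ : B ≃ C) {x y : P.obj C} :
      CongrGen P r C x y → CongrGen P r B (P.map φ x) (P.map φ y)
  | comp {B C : Type u} [Finite B] [Finite C] (b : B) {x x' : P.obj B} {y y' : P.obj C} :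
      CongrGen P r B x x' → CongrGen P r C y y' →
        CongrGen P r (Glue B b C) (P.comp x b y) (P.comp x' b y')

/-- The generated congruence in arity `B`, as a setoid. -/
def congrSetoid (P : SetOperad.{u})
    (r : (B : Type u) → [Finite B] → P.obj B → P.obj B → Prop) (B : Type u) [Finite B] :
    Setoid (P.obj B) where
  r := CongrGen P r B
  iseqv := ⟨CongrGen.refl, CongrGen.symm, CongrGen.trans⟩

/-- The quotient of a set operad by the operadic congruence generated by `r`. -/
def quotient (P : SetOperad.{u})
    (r : (B : Type u) → [Finite B] → P.obj B → P.obj B → Prop) : SetOperad.{u} where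
  obj B _ := Quotient (P.congrSetoid r B)
  map φ := Quotient.map (P.map φ) fun _ _ h => CongrGen.map φ h
  map_refl B _ := by
    rintro ⟨x⟩
    exact congrArg _ (P.map_refl B x)
  map_trans φ ψ := by
    rintro ⟨x⟩
    exact congrArg _ (P.map_trans φ ψ x)
  one := Quotient.mk _ P.one
  comp x b y := Quotient.map₂ (fun x y => P.comp x b y)
    (fun _ _ h _ _ h' => CongrGen.comp b h h') x y
  isOperad :=
    { positive := fun B _ _ => ⟨by
        rintro ⟨x⟩
        exact (P.isOperad.positive B).false x⟩
      map_comp := by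
        rintro B B' C C' _ _ _ _ φ ψ b ⟨α⟩ ⟨β⟩
        exact congrArg (Quotient.mk _) (P.isOperad.map_comp φ ψ b α β)
      comp_seq := by
        rintro B C D _ _ _ b c ⟨α⟩ ⟨β⟩ ⟨γ⟩
        exact congrArg (Quotient.mk _) (P.isOperad.comp_seq b c α β γ)
      comp_par := by
        rintro B C D _ _ _ b b' h ⟨α⟩ ⟨β⟩ ⟨γ⟩
        exact congrArg (Quotient.mk _) (P.isOperad.comp_par b b' h α β γ)
      one_comp := by
        rintro C _ ⟨α⟩
        exact congrArg (Quotient.mk _) (P.isOperad.one_comp α)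
      comp_one := by
        rintro B _ b ⟨α⟩
        exact congrArg (Quotient.mk _) (P.isOperad.comp_one b α) }

end SetOperad

/-! ## The magmatic operad -/

namespace Magmatic

/-- The labels of the leaves of a planar binary tree, from left to right. -/
def leaves {B : Type u} : FreeMagma B → List B
  | FreeMagma.of x => [x]
  | FreeMagma.mul s t => leaves s ++ leaves t

@[simp] theorem leaves_of {B : Type u} (x : B) : leaves (FreeMagma.of x) = [x] := rfl

@[simp] theorem leaves_mul {B : Type u} (s t : FreeMagma B) :
    leaves (s * t) = leaves s ++ leaves t := rfl

theorem lift_lift {B C D : Type u} (f : B → FreeMagma C) (g : C → FreeMagma D)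
    (t : FreeMagma B) :
    FreeMagma.lift g (FreeMagma.lift f t) = FreeMagma.lift (fun x => FreeMagma.lift g (f x)) t := by
  induction t using FreeMagma.recOnMul with
  | ih1 x => simp
  | ih2 s t hs ht => simp [hs, ht]

theorem lift_of_eq {B : Type u} (t : FreeMagma B) : FreeMagma.lift FreeMagma.of t = t := by
  induction t using FreeMagma.recOnMul with
  | ih1 x => simp
  | ih2 s t hs ht => simp [hs, ht]

theorem leaves_lift {B C : Type u} (f : B → FreeMagma C) (t : FreeMagma B) :
    leaves (FreeMagma.lift f t) = (leaves t).flatMap fun x => leaves (f x) := by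
  induction t using FreeMagma.recOnMul with
  | ih1 x => simp
  | ih2 s t hs ht => simp [hs, ht]

theorem leaves_lift_of {B C : Type u} (f : B → C) (t : FreeMagma B) :
    leaves (FreeMagma.lift (fun x => FreeMagma.of (f x)) t) = (leaves t).map f := by
  induction t using FreeMagma.recOnMul with
  | ih1 x => simp
  | ih2 s t hs ht => simp [hs, ht]

/-- Planar binary trees whose leaves are labeled bijectively by `B`: every element of `B` is
the label of exactly one leaf. -/
def LTree (B : Type u) : Type u :=
  {t : FreeMagma B // (leaves t).Nodup ∧ ∀ b, b ∈ leaves t}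

/-- Relabeling along a bijection. -/
def LTree.map {B C : Type u} (φ : B ≃ C) (t : LTree C) : LTree B :=
  ⟨FreeMagma.lift (fun x => FreeMagma.of (φ.symm x)) t.1, by
    rw [leaves_lift_of]
    refine ⟨t.2.1.map φ.symm.injective, fun b => ?_⟩
    exact List.mem_map.2 ⟨φ b, t.2.2 _, by simp⟩⟩

open Classical in
/-- The tree by which a leaf labeled `x` is replaced when `t` is plugged at the leaf `b`. -/
noncomputable def plug {B C : Type u} (b : B) (t : FreeMagma C) (x : B) :
    FreeMagma (Glue B b C) :=
  if h : x = b then FreeMagma.lift (fun c => FreeMagma.of (Sum.inr c)) t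
  else FreeMagma.of (Sum.inl ⟨x, h⟩)

@[simp] theorem plug_self {B C : Type u} (b : B) (t : FreeMagma C) :
    plug b t b = FreeMagma.lift (fun c => FreeMagma.of (Sum.inr c)) t := by simp [plug]

theorem plug_ne {B C : Type u} {b : B} (t : FreeMagma C) {x : B} (h : x ≠ b) :
    plug b t x = FreeMagma.of (Sum.inl ⟨x, h⟩) := by simp [plug, h]

theorem mem_leaves_plug {B C : Type u} {b : B} {t : FreeMagma C} {x : B} {z : Glue B b C}
    (h : z ∈ leaves (plug b t x)) : Sum.elim Subtype.val (fun _ => b) z = x := by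
  by_cases hx : x = b
  · subst hx
    rw [plug_self, leaves_lift_of] at h
    obtain ⟨c, -, rfl⟩ := List.mem_map.1 h
    rfl
  · rw [plug_ne t hx] at h
    simp at h
    subst h
    rfl

/-- Plugging the tree `t` on the tree `s` at the leaf labeled `b`. -/
noncomputable def LTree.comp {B C : Type u} (s : LTree B) (b : B) (t : LTree C) :
    LTree (Glue B b C) :=
  ⟨FreeMagma.lift (plug b t.1) s.1, by
    rw [leaves_lift]
    constructor
    · rw [List.nodup_flatMap]
      constructor
      · intro x _
        by_cases hx : x = b
        · subst hx
          rw [plug_self, leaves_lift_of]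
          exact t.2.1.map Sum.inr_injective
        · rw [plug_ne _ hx]
          simp
      · refine s.2.1.imp fun {x y} hxy => ?_
        intro z hz hz'
        exact hxy ((mem_leaves_plug hz).symm.trans (mem_leaves_plug hz'))
    · rintro (x | c)
      · refine List.mem_flatMap.2 ⟨x.1, s.2.2 _, ?_⟩
        rw [plug_ne _ x.2]
        simp
      · refine List.mem_flatMap.2 ⟨b, s.2.2 _, ?_⟩
        rw [plug_self, leaves_lift_of]
        exact List.mem_map.2 ⟨c, t.2.2 _, rfl⟩⟩

/-- The magmatic operad: planar binary trees with leaves labeled bijectively, with composition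
given by plugging a tree at a leaf, and the one-leaf tree as unit. -/
noncomputable def operad : SetOperad.{u} where
  obj B _ := LTree B
  map φ := LTree.map φ
  map_refl B _ x := Subtype.ext (lift_of_eq x.1)
  map_trans φ ψ x := Subtype.ext (by simp [LTree.map, lift_lift])
  one := ⟨FreeMagma.of PUnit.unit, by simp⟩
  comp s b t := s.comp b t
  isOperad :=
    { positive := fun B _ _ => ⟨fun t => by
        have : ∀ s : FreeMagma B, False := fun s => by
          induction s using FreeMagma.recOnMul with
          | ih1 x => exact isEmptyElim x
          | ih2 s t hs ht => exact hs
        exact this t.1⟩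
      map_comp := by
        intro B B' C C' _ _ _ _ φ ψ b α β
        refine Subtype.ext ?_
        simp only [LTree.map, LTree.comp, lift_lift]
        congr 2
        funext x
        by_cases hx : x = φ b
        · subst hx
          simp [lift_lift, Glue.congr]
        · have hx' : φ.symm x ≠ b := fun e => hx (by simp [← e])
          simp [plug_ne _ hx, plug_ne _ hx', Glue.congr, Equiv.subtypeEquiv]
      comp_seq := by
        intro B C D _ _ _ b c α β γ
        refine Subtype.ext ?_
        simp only [LTree.map, LTree.comp, lift_lift]
        congr 2
        funext x
        by_cases hx : x = b
        · subst hx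
          simp only [plug_self, lift_lift]
          congr 2
          funext y
          by_cases hy : y = c
          · subst hy
            simp [lift_lift, Glue.seqEquiv]
          · have hy' : (Sum.inr y : Glue B x C) ≠ Sum.inr c :=
              fun e => hy (Sum.inr_injective e)
            simp [plug_ne _ hy, plug_ne _ hy', Glue.seqEquiv]
        · have hx' : (Sum.inl ⟨x, hx⟩ : Glue B b C) ≠ Sum.inr c := by simp
          simp [plug_ne _ hx, plug_ne _ hx', Glue.seqEquiv]
      comp_par := by
        intro B C D _ _ _ b b' h α β γ
        refine Subtype.ext ?_
        simp only [LTree.map, LTree.comp, lift_lift]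
        congr 2
        funext x
        by_cases hx : x = b
        · subst hx
          have hy (y : C) : (Sum.inr y : Glue B x C) ≠ Sum.inl ⟨b', h⟩ := by simp
          simp [lift_lift, plug_ne _ h.symm, plug_ne _ (hy _), Glue.parEquiv, Glue.parFun]
        · by_cases hx2 : x = b'
          · subst hx2
            have hy (y : D) : (Sum.inr y : Glue B x D) ≠ Sum.inl ⟨b, h.symm⟩ := by simp
            simp [lift_lift, plug_ne _ h, plug_ne _ (hy _), Glue.parEquiv, Glue.parFun]
          · have h1 : (Sum.inl ⟨x, hx⟩ : Glue B b C) ≠ Sum.inl ⟨b', h⟩ := by simpa using hx2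
            have h2 : (Sum.inl ⟨x, hx2⟩ : Glue B b' D) ≠ Sum.inl ⟨b, h.symm⟩ := by simpa using hx
            simp [plug_ne _ hx, plug_ne _ hx2, plug_ne _ h1, plug_ne _ h2, Glue.parEquiv,
              Glue.parFun]
      one_comp := by
        intro C _ α
        refine Subtype.ext ?_
        simp [LTree.map, LTree.comp, Glue.oneLeftEquiv]
      comp_one := by
        intro B _ b α
        refine Subtype.ext ?_
        simp only [LTree.map, LTree.comp]
        congr 2
        funext x
        by_cases hx : x = b
        · subst hx
          simp [Glue.oneRightEquiv]
        · simp [plug_ne _ hx, Glue.oneRightEquiv, hx] }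

/-- A two-element set of labels `{1, 2}`. -/
inductive Two : Type u
  | one
  | two

instance : Finite Two.{u} :=
  Finite.of_surjective (fun b : Bool => cond b Two.one Two.two) (by
    rintro (_ | _)
    · exact ⟨true, rfl⟩
    · exact ⟨false, rfl⟩)

/-- The generator `μ`: the product of the inputs `1` and `2`, in this order. -/
def mu : operad.{u}.obj Two.{u} :=
  ⟨FreeMagma.of Two.one * FreeMagma.of Two.two, by simp, by rintro (_ | _) <;> simp⟩

end Magmatic

/-! ## The NAPNAP' operad -/

open Classical Magmatic in
/-- The two defining relations.
The tree `μ ∘_2 μ` is `x(yz)` with `x = inl 1`, `y = inr 1`, `z = inr 2`, and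
the tree `μ ∘_1 μ` is `(xy)z` with `x = inr 1`, `y = inr 2`, `z = inl 2`;
each relation identifies the tree with the one obtained by exchanging the labels `x` and `y`. -/
inductive NapNapRel : (B : Type u) → [Finite B] →
    Magmatic.operad.{u}.obj B → Magmatic.operad.{u}.obj B → Prop
  | nap : NapNapRel (Glue Two.{u} Two.two Two.{u})
      (operad.comp mu Two.two mu)
      (operad.map (Equiv.swap (Sum.inl ⟨Two.one, by simp⟩) (Sum.inr Two.one))
        (operad.comp mu Two.two mu))
  | nap' : NapNapRel (Glue Two.{u} Two.one Two.{u})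
      (operad.comp mu Two.one mu)
      (operad.map (Equiv.swap (Sum.inr Two.one) (Sum.inr Two.two))
        (operad.comp mu Two.one mu))

/-- The NAPNAP' operad: the magmatic operad modulo `x(yz) = y(xz)` and `(xy)z = (yx)z`. -/
noncomputable def napNapOperad : SetOperad.{u} :=
  Magmatic.operad.quotient fun B _ => NapNapRel B

/-! ## Corollas -/

/-- A quasi-order is a corolla structure if it has a unique minimum `r` and every element
different from `r` is maximal (in the sense of quasi-orders). -/
def IsCorolla (B : Type u) [Preorder B] : Prop :=
  ∃ r : B, IsBot r ∧ (∀ x : B, IsBot x → x = r) ∧ ∀ x : B, x ≠ r → IsMax x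

/-- The set of corolla structures on `B`. -/
def Corolla (B : Type u) : Type u :=
  {q : Preorder B // @IsCorolla B q}

namespace Corolla

/-- The quasi-order of a corolla. -/
def le {B : Type u} (β : Corolla B) (x y : B) : Prop := β.1.le x y

/-- `r` is the root, i.e. the minimum, of the corolla. -/
def IsRoot {B : Type u} (β : Corolla B) (r : B) : Prop := ∀ x, β.le r x

protected theorem le_refl {B : Type u} (β : Corolla B) (x : B) : β.le x x := β.1.le_refl x

protected theorem le_trans {B : Type u} (β : Corolla B) {x y z : B} (h : β.le x y) (h' : β.le y z) :
    β.le x z := β.1.le_trans x y z h h'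

theorem exists_root {B : Type u} (β : Corolla B) :
    ∃ r, β.IsRoot r ∧ (∀ x, β.IsRoot x → x = r) ∧ ∀ x, x ≠ r → ∀ y, β.le x y → β.le y x := by
  obtain ⟨r, h1, h2, h3⟩ := β.2
  exact ⟨r, h1, h2, fun x hx y hy => h3 x hx hy⟩

theorem IsRoot.eq {B : Type u} {β : Corolla B} {x y : B} (hx : β.IsRoot x) (hy : β.IsRoot y) :
    x = y := by
  obtain ⟨r, -, h, -⟩ := β.exists_root
  rw [h x hx, h y hy]

theorem le_symm {B : Type u} {β : Corolla B} {x y : B} (hx : ¬ β.IsRoot x) (h : β.le x y) :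
    β.le y x := by
  obtain ⟨r, h1, -, h3⟩ := β.exists_root
  exact h3 x (fun e => hx (e ▸ h1)) y h

/-- Two corollas with the same order relation are equal. -/
theorem ext {B : Type u} {β γ : Corolla B} (h : ∀ x y, β.le x y ↔ γ.le x y) : β = γ :=
  Subtype.ext (Preorder.ext h)

/-- A corolla from its order relation. -/
def mk {B : Type u} (le : B → B → Prop) (hr : ∀ x, le x x)
    (ht : ∀ x y z, le x y → le y z → le x z)
    (hc : ∃ r, (∀ x, le r x) ∧ (∀ x, (∀ y, le x y) → x = r) ∧
      ∀ x, x ≠ r → ∀ y, le x y → le y x) : Corolla B :=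
  ⟨{ le := le, le_refl := hr, le_trans := ht }, by
    obtain ⟨r, h1, h2, h3⟩ := hc
    exact ⟨r, h1, h2, fun x hx y hy => h3 x hx y hy⟩⟩

/-- Relabeling: the corolla structure on `B` transported from `C` along `φ : B ≃ C`. -/
def map {B C : Type u} (φ : B ≃ C) (γ : Corolla C) : Corolla B :=
  mk (fun x y => γ.le (φ x) (φ y)) (fun _ => γ.le_refl _) (fun _ _ _ => γ.le_trans) (by
    obtain ⟨r, h1, h2, h3⟩ := γ.exists_root
    refine ⟨φ.symm r, fun x => by simpa using h1 (φ x), fun x hx => ?_, fun x hx y hy => ?_⟩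
    · rw [Equiv.eq_symm_apply]
      exact h2 _ fun y => by simpa using hx (φ.symm y)
    · exact h3 _ (fun e => hx (by simp [← e])) _ hy)

/-- The unique corolla structure on the one-element set. -/
def one : Corolla PUnit.{u + 1} :=
  mk (fun _ _ => True) (fun _ => trivial) (fun _ _ _ _ _ => trivial)
    ⟨PUnit.unit, fun _ => trivial, fun _ _ => rfl, fun _ _ _ _ => trivial⟩

/-- The order on `B ⊔_b C` when `b` is the root of `β`: the root of `γ` is below everything, the
other elements of `B` and `C` are compared as before within `B` and within `C`, and
they are incomparable across `B` and `C`. -/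
def rootLe {B C : Type u} (β : Corolla B) (b : B) (γ : Corolla C) :
    Glue B b C → Glue B b C → Prop
  | Sum.inl x, Sum.inl y => β.le x.1 y.1
  | Sum.inl _, Sum.inr _ => False
  | Sum.inr c, Sum.inl _ => γ.IsRoot c
  | Sum.inr c, Sum.inr d => γ.le c d

/-- Composition at the root: the new root is the root of `γ`, and all branches are kept. -/
def compRoot {B C : Type u} (β : Corolla B) (b : B) (hb : β.IsRoot b) (γ : Corolla C) :
    Corolla (Glue B b C) :=
  mk (rootLe β b γ)
    (by
      rintro (x | c)
      · exact β.le_refl _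
      · exact γ.le_refl _)
    (by
      rintro (x | c) (y | d) (z | e) h h'
      · exact β.le_trans h h'
      · exact h'
      · exact h.elim
      · exact h.elim
      · exact h
      · exact h'.elim
      · exact fun w => γ.le_trans h (h' w)
      · exact γ.le_trans h h')
    (by
      obtain ⟨r, h1, h2, h3⟩ := γ.exists_root
      refine ⟨Sum.inr r, ?_, ?_, ?_⟩
      · rintro (x | c)
        · exact h1
        · exact h1 c
      · rintro (x | c) h
        · exact (h (Sum.inr r)).elim
        · exact congrArg Sum.inr (h2 c fun d => h (Sum.inr d))
      · rintro (x | c) hx (y | d) h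
        · exact le_symm (fun hr => x.2 (hr.eq hb)) h
        · exact h.elim
        · exact (hx (congrArg Sum.inr (h2 c h))).elim
        · exact h3 c (fun e => hx (congrArg Sum.inr e)) d h)

/-- The map `B ⊔_b C → B` which sends all elements of `C` to `b`. -/
def collapse {B C : Type u} (b : B) : Glue B b C → B
  | Sum.inl x => x.1
  | Sum.inr _ => b

/-- Composition at a non-root element `b`: in the branch of `b`, the element `b` is replaced by
the whole set `C`. -/
def compBranch {B C : Type u} (β : Corolla B) (b : B) (hb : ¬ β.IsRoot b) :
    Corolla (Glue B b C) :=
  mk (fun x y => β.le (collapse b x) (collapse b y)) (fun _ => β.le_refl _)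
    (fun _ _ _ => β.le_trans) (by
      obtain ⟨r, h1, h2, h3⟩ := β.exists_root
      have hrb : r ≠ b := fun e => hb (e ▸ h1)
      refine ⟨Sum.inl ⟨r, hrb⟩, fun x => h1 _, ?_, ?_⟩
      · intro x hx
        have hroot : β.IsRoot (collapse b x) := fun y =>
          β.le_trans (hx (Sum.inl ⟨r, hrb⟩)) (h1 y)
        rcases x with x | c
        · exact congrArg Sum.inl (Subtype.ext (h2 x.1 hroot))
        · exact (hb hroot).elim
      · intro x hx y hy
        refine h3 _ ?_ _ hy
        rcases x with x | c
        · exact fun e => hx (congrArg Sum.inl (Subtype.ext e))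
        · exact hrb.symm)

open Classical in
/-- The partial composition `β ∘_b γ` of corollas. -/
noncomputable def comp {B C : Type u} (β : Corolla B) (b : B) (γ : Corolla C) :
    Corolla (Glue B b C) :=
  if hb : β.IsRoot b then β.compRoot b hb γ
  else β.compBranch b hb

end Corolla

/-- The species of corollas. -/
def corollaSpecies : SetSpecies.{u} where
  obj B _ := Corolla B
  map φ := Corolla.map φ
  map_refl _ _ _ := Corolla.ext fun _ _ => Iff.rfl
  map_trans _ _ _ := Corolla.ext fun _ _ => Iff.rfl

/-- The species of corollas with its unit and partial compositions. -/
noncomputable def corollaData : OperadData.{u} where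
  toSetSpecies := corollaSpecies
  one := (Corolla.one : Corolla PUnit.{u + 1})
  comp := fun {B C} _ _ (β : Corolla B) (b : B) (γ : Corolla C) => Corolla.comp β b γ

/-!
A planar binary tree is uniquely of the form `s₁ * (s₂ * (⋯ * (sₖ * r)))` with `r` a leaf. The
isomorphism sends it to the corolla with root `r` whose branches are the sets of labels of
`s₁, …, sₖ` (`toCorolla`).

This map is compatible with relabelings, units and partial compositions (`toCorolla_comp`) and is
surjective (`toCorolla_surjective`). Hence the operad axioms for corollas follow from those of the
magmatic operad (`OperadData.IsOperad.of_surjective`). Both defining relations of NAPNAP' hold for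
corollas, so the map descends to the quotient, and it remains to see that two trees with the same
corolla are identified in NAPNAP'.

The relation `x(yz) = y(xz)` allows the factors `s₁, …, sₖ` to be permuted. Moreover a left factor
may be replaced by any tree with the same labels: modulo the relation "`su = s'u` for all `u`",
left factors form a semigroup which is commutative by `(xy)z = (yx)z`, and associative because
`(ab)c ~ c(ab) ~ a(cb) ~ a(bc)` (`napNapCon_mul_of_perm`). So a tree only depends on its root and
on the multiset of the multisets of labels of its left factors (`napNapCon_of_toCorolla_eq`).

This computation takes place in the free magma modulo the congruence `napNapCon`, where labels may
repeat and no label set has to be tracked. It is transferred to the operadic congruence in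
`napNapCongr_of_napNapCon`: every step between two trees with labels in `X` is the image, under a
map `A → X`, of an operadic congruence between trees labeled bijectively by `A` (`LinRel`). Such
steps can be chained because all trees in a chain starting from a tree with distinct labels have
distinct labels.
-/

namespace Magmatic

/-! ### Root and branches of a planar binary tree -/

/-- The label of the rightmost leaf of a planar binary tree. -/
def root {B : Type u} : FreeMagma B → B
  | FreeMagma.of x => x
  | FreeMagma.mul _ t => root t

/-- The left factors `s₁, …, sₖ` met along the rightmost path of the tree
`s₁ * (s₂ * (⋯ * (sₖ * r)))`, whose rightmost leaf is `r`. -/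
def branches {B : Type u} : FreeMagma B → List (FreeMagma B)
  | FreeMagma.of _ => []
  | FreeMagma.mul s t => s :: branches t

section Tree

variable {B C : Type u}

@[simp] theorem root_of (x : B) : root (FreeMagma.of x) = x := rfl

@[simp] theorem root_mul (s t : FreeMagma B) : root (s * t) = root t := rfl

@[simp] theorem branches_of (x : B) : branches (FreeMagma.of x) = [] := rfl

@[simp] theorem branches_mul (s t : FreeMagma B) : branches (s * t) = s :: branches t := rfl

theorem leaves_ne_nil (t : FreeMagma B) : leaves t ≠ [] := by
  induction t using FreeMagma.recOnMul with
  | ih1 x => simp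
  | ih2 s t hs ht => simp [hs]

theorem leaves_eq_branches_append_root (t : FreeMagma B) :
    leaves t = (branches t).flatMap leaves ++ [root t] := by
  induction t using FreeMagma.recOnMul with
  | ih1 x => simp
  | ih2 s t hs ht => rw [leaves_mul, ht]; simp

theorem foldr_branches (t : FreeMagma B) :
    (branches t).foldr (· * ·) (FreeMagma.of (root t)) = t := by
  induction t using FreeMagma.recOnMul with
  | ih1 x => simp
  | ih2 s t hs ht => simp [ht]

theorem root_lift (f : B → FreeMagma C) (t : FreeMagma B) :
    root (FreeMagma.lift f t) = root (f (root t)) := by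
  induction t using FreeMagma.recOnMul with
  | ih1 x => simp
  | ih2 s t hs ht => simp [ht]

theorem branches_lift (f : B → FreeMagma C) (t : FreeMagma B) :
    branches (FreeMagma.lift f t) =
      (branches t).map (FreeMagma.lift f) ++ branches (f (root t)) := by
  induction t using FreeMagma.recOnMul with
  | ih1 x => simp
  | ih2 s t hs ht => simp [ht]

theorem mem_leaves_iff {t : FreeMagma B} {x : B} :
    x ∈ leaves t ↔ (∃ s ∈ branches t, x ∈ leaves s) ∨ x = root t := by
  rw [leaves_eq_branches_append_root t]
  simp

theorem root_notMem_of_nodup {t : FreeMagma B} (h : (leaves t).Nodup) {s : FreeMagma B}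
    (hs : s ∈ branches t) : root t ∉ leaves s := by
  rw [leaves_eq_branches_append_root t] at h
  intro hr
  exact (List.nodup_append.1 h).2.2 _ (List.mem_flatMap.2 ⟨s, hs, hr⟩) _ (by simp) rfl

theorem pairwise_disjoint_branches {t : FreeMagma B} (h : (leaves t).Nodup) :
    (branches t).Pairwise fun s s' => List.Disjoint (leaves s) (leaves s') := by
  rw [leaves_eq_branches_append_root t] at h
  exact (List.nodup_flatMap.1 (List.nodup_append.1 h).1).2

theorem nodup_of_mem_branches {t : FreeMagma B} (h : (leaves t).Nodup) {s : FreeMagma B}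
    (hs : s ∈ branches t) : (leaves s).Nodup := by
  rw [leaves_eq_branches_append_root t] at h
  exact (List.nodup_flatMap.1 (List.nodup_append.1 h).1).1 s hs

/-- Distinct branches of a tree with distinct labels have no label in common. -/
theorem branch_eq_of_mem {t : FreeMagma B} (h : (leaves t).Nodup) {s s' : FreeMagma B}
    (hs : s ∈ branches t) (hs' : s' ∈ branches t) {x : B} (hx : x ∈ leaves s)
    (hx' : x ∈ leaves s') : s = s' := by
  by_contra hne
  have hsym : Std.Symm fun s s' : FreeMagma B => List.Disjoint (leaves s) (leaves s') :=
    ⟨fun _ _ h => h.symm⟩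
  exact (pairwise_disjoint_branches h).forall hs hs' hne hx hx'

/-! ### The corolla of a tree -/

/-- The quasi-order carried by a tree: the root lies below everything, and two elements of a
common branch are equivalent. -/
def treeLe (t : FreeMagma B) (x y : B) : Prop :=
  x = root t ∨ ∃ s ∈ branches t, x ∈ leaves s ∧ y ∈ leaves s

theorem treeLe_mul {s t : FreeMagma B} {x y : B} :
    treeLe (s * t) x y ↔ (x ∈ leaves s ∧ y ∈ leaves s) ∨ treeLe t x y := by
  simp [treeLe, or_left_comm]

theorem treeLe_iff_mem {t : FreeMagma B} (h : (leaves t).Nodup) {s : FreeMagma B}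
    (hs : s ∈ branches t) {x y : B} (hx : x ∈ leaves s) : treeLe t x y ↔ y ∈ leaves s := by
  constructor
  · rintro (rfl | ⟨s', hs', hx', hy⟩)
    · exact (root_notMem_of_nodup h hs hx).elim
    · rwa [branch_eq_of_mem h hs hs' hx hx']
  · exact fun hy => Or.inr ⟨s, hs, hx, hy⟩

/-- The corolla of a tree: its root is the rightmost leaf, and its branches are the sets of labels
of the left factors along the rightmost path. -/
def toCorolla (t : LTree B) : Corolla B :=
  Corolla.mk (treeLe t.1)
    (fun x => (mem_leaves_iff.1 (t.2.2 x)).symm.imp id fun ⟨s, hs, hx⟩ => ⟨s, hs, hx, hx⟩)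
    (by
      rintro x y z (h | ⟨s, hs, hx, hy⟩) h'
      · exact Or.inl h
      · exact Or.inr ⟨s, hs, hx, (treeLe_iff_mem t.2.1 hs hy).1 h'⟩)
    (by
      refine ⟨root t.1, fun _ => Or.inl rfl, fun x hx => ?_, ?_⟩
      · rcases hx (root t.1) with h | ⟨s, hs, -, h⟩
        · exact h
        · exact (root_notMem_of_nodup t.2.1 hs h).elim
      · rintro x hx y (h | ⟨s, hs, h, h'⟩)
        · exact (hx h).elim
        · exact Or.inr ⟨s, hs, h', h⟩)

theorem toCorolla_le (t : LTree B) (x y : B) : (toCorolla t).le x y ↔ treeLe t.1 x y := Iff.rfl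

theorem toCorolla_isRoot_iff (t : LTree B) (x : B) : (toCorolla t).IsRoot x ↔ x = root t.1 := by
  have hr : (toCorolla t).IsRoot (root t.1) := fun _ => Or.inl rfl
  exact ⟨fun h => h.eq hr, fun h => h ▸ hr⟩

theorem toCorolla_map (φ : B ≃ C) (t : LTree C) :
    toCorolla (t.map φ) = (toCorolla t).map φ := by
  refine Corolla.ext fun x y => ?_
  change treeLe (FreeMagma.lift _ t.1) x y ↔ treeLe t.1 (φ x) (φ y)
  simp only [treeLe, root_lift, branches_lift, root_of, branches_of, List.append_nil, List.mem_map,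
    exists_exists_and_eq_and, leaves_lift_of, Equiv.eq_symm_apply, Equiv.symm_apply_eq,
    exists_eq_right]

/-- After plugging `t` at `b`, a tree carries exactly the labels which collapse to a label of the
original tree. -/
theorem mem_leaves_lift_plug {b : B} (t : LTree C) (s : FreeMagma B) (z : Glue B b C) :
    z ∈ leaves (FreeMagma.lift (plug b t.1) s) ↔ Corolla.collapse b z ∈ leaves s := by
  rw [leaves_lift, List.mem_flatMap]
  constructor
  · rintro ⟨x, hx, hz⟩
    have := mem_leaves_plug hz
    rcases z with z | c
    · change z.1 = x at this
      change z.1 ∈ leaves s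
      rwa [this]
    · change b = x at this
      change b ∈ leaves s
      rwa [this]
  · intro h
    refine ⟨_, h, ?_⟩
    rcases z with z | c
    · simp [Corolla.collapse, plug_ne _ z.2]
    · simp [Corolla.collapse, leaves_lift_of, t.2.2 c]

theorem toCorolla_comp (s : LTree B) (b : B) (t : LTree C) :
    toCorolla (s.comp b t) = (toCorolla s).comp b (toCorolla t) := by
  refine Corolla.ext fun x y => ?_
  unfold Corolla.comp
  split_ifs with hb
  · have hb' := (toCorolla_isRoot_iff s b).1 hb
    have hs : ∀ A ∈ branches s.1, b ∉ leaves A := fun A hA =>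
      hb' ▸ root_notMem_of_nodup s.2.1 hA
    change treeLe (FreeMagma.lift _ s.1) x y ↔ Corolla.rootLe (toCorolla s) b (toCorolla t) x y
    rw [treeLe, root_lift, branches_lift, ← hb', plug_self, root_lift, branches_lift]
    simp only [branches_of, List.append_nil, List.mem_append, or_and_right, exists_or,
      List.mem_map, exists_exists_and_eq_and, mem_leaves_lift_plug, leaves_lift_of, root_of]
    rcases x with x | c <;> rcases y with y | d
    · simp [Corolla.rootLe, Corolla.collapse, toCorolla_le, treeLe, ← hb', x.2]
    · simp only [Corolla.rootLe, Corolla.collapse, iff_false]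
      rintro (h | ⟨A, hA, -, h⟩ | ⟨A, hA, h, -⟩)
      · simp at h
      · exact hs A hA h
      · simp at h
    · simp only [Corolla.rootLe, Corolla.collapse, toCorolla_isRoot_iff]
      constructor
      · rintro (h | ⟨A, hA, h, -⟩ | ⟨A, hA, -, h⟩)
        · exact Sum.inr_injective h
        · exact (hs A hA h).elim
        · simp at h
      · rintro rfl
        exact Or.inl rfl
    · simp only [Corolla.rootLe, Corolla.collapse, toCorolla_le, treeLe]
      refine or_congr (by simp) ?_
      rw [or_iff_right]
      · simp
      · rintro ⟨A, hA, h, -⟩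
        exact hs A hA h
  · have hb' : root s.1 ≠ b := fun e => hb ((toCorolla_isRoot_iff s b).2 e.symm)
    change treeLe (FreeMagma.lift _ s.1) x y ↔
      treeLe s.1 (Corolla.collapse b x) (Corolla.collapse b y)
    rw [treeLe, root_lift, branches_lift, plug_ne _ hb']
    simp only [branches_of, List.append_nil, List.mem_map, exists_exists_and_eq_and,
      mem_leaves_lift_plug, root_of, treeLe]
    refine or_congr ?_ Iff.rfl
    rcases x with x | c
    · simp [Corolla.collapse, Subtype.ext_iff]
    · simp [Corolla.collapse, hb'.symm]

/-! ### Every corolla comes from a tree -/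

theorem exists_leaves_eq_finset (A : Finset B) (hA : A.Nonempty) :
    ∃ s : FreeMagma B, (leaves s).Nodup ∧ ∀ x, x ∈ leaves s ↔ x ∈ A := by
  induction hA using Finset.Nonempty.cons_induction with
  | singleton a => exact ⟨FreeMagma.of a, by simp, by simp⟩
  | cons a A ha hA ih =>
    obtain ⟨s, hs, hs'⟩ := ih
    exact ⟨FreeMagma.of a * s, by simp [hs, hs', ha], by simp [hs']⟩

/-- A union of branches of `β`, together with the root, carries a tree inducing the order of `β`;
the branches are added one at a time. -/
theorem exists_treeLe_iff (β : Corolla B) {r : B} (hr : β.IsRoot r) (S : Finset B) (hrS : r ∉ S)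
    (hS : ∀ x ∈ S, ∀ y, β.le x y → y ∈ S) :
    ∃ t : FreeMagma B, (leaves t).Nodup ∧ (∀ x, x ∈ leaves t ↔ x = r ∨ x ∈ S) ∧ root t = r ∧
      ∀ x ∈ S, ∀ y, treeLe t x y ↔ β.le x y := by
  classical
  induction S using Finset.strongInduction with
  | H S ih =>
    rcases S.eq_empty_or_nonempty with rfl | ⟨a, ha⟩
    · exact ⟨FreeMagma.of r, by simp, by simp, by simp, by simp⟩
    have hsymm {x y : B} (hx : x ∈ S) (h : β.le x y) : β.le y x :=
      Corolla.le_symm (fun hx' => hrS (hx'.eq hr ▸ hx)) h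
    obtain ⟨s, hs, hs'⟩ := exists_leaves_eq_finset (S.filter (β.le a))
      ⟨a, by simp [ha, β.le_refl]⟩
    obtain ⟨t, ht, ht', hroot, hle⟩ := ih (S.filter fun x => ¬ β.le a x)
      (Finset.filter_ssubset.2 ⟨a, ha, by simp [β.le_refl]⟩) (by simp [hrS]) (by
        intro x hx y hxy
        rw [Finset.mem_filter] at hx ⊢
        exact ⟨hS x hx.1 y hxy, fun h => hx.2 (β.le_trans h (hsymm hx.1 hxy))⟩)
    simp only [Finset.mem_filter] at hs' ht' hle
    refine ⟨s * t, ?_, fun x => ?_, hroot, fun x hx y => ?_⟩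
    · rw [leaves_mul, List.nodup_append']
      refine ⟨hs, ht, fun x hx hx' => ?_⟩
      rw [hs'] at hx
      rcases (ht' x).1 hx' with rfl | h
      · exact hrS hx.1
      · exact h.2 hx.2
    · rw [leaves_mul, List.mem_append, hs', ht']
      tauto
    · rw [treeLe_mul, hs', hs']
      by_cases hax : β.le a x
      · have hnot : ¬ treeLe t x y := by
          rintro (rfl | ⟨A, hA, hxA, -⟩)
          · exact hrS (hroot ▸ hx)
          · rcases (ht' x).1 (mem_leaves_iff.2 (Or.inl ⟨A, hA, hxA⟩)) with rfl | h
            · exact hrS hx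
            · exact h.2 hax
        constructor
        · rintro (h | h)
          · exact β.le_trans (hsymm ha hax) h.2.2
          · exact (hnot h).elim
        · exact fun h => Or.inl ⟨⟨hx, hax⟩, hS x hx y h, β.le_trans hax h⟩
      · rw [hle x ⟨hx, hax⟩]
        tauto

theorem toCorolla_surjective [Finite B] : Function.Surjective (toCorolla (B := B)) := by
  classical
  intro β
  have := Fintype.ofFinite B
  obtain ⟨r, hr, -, -⟩ := β.exists_root
  obtain ⟨t, ht, ht', hroot, hle⟩ := exists_treeLe_iff β hr (Finset.univ.erase r) (by simp) (by
    intro x hx y hxy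
    simp only [Finset.mem_erase, Finset.mem_univ, and_true] at hx ⊢
    rintro rfl
    exact hx (Corolla.IsRoot.eq (fun z => β.le_trans hxy (hr z)) hr))
  refine ⟨⟨t, ht, fun x => (ht' x).2 (by simp [em])⟩, Corolla.ext fun x y => ?_⟩
  change treeLe t x y ↔ β.le x y
  by_cases hx : x = r
  · subst hx
    exact iff_of_true (Or.inl hroot.symm) (hr y)
  · exact hle x (by simp [hx]) y

end Tree

/-! ### The NAPNAP' congruence on the free magma -/

/-- The instances of `x(yz) = y(xz)` and `(xy)z = (yx)z` in the free magma. -/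
inductive NapNapPair {X : Type u} : FreeMagma X → FreeMagma X → Prop
  | nap (x y z : FreeMagma X) : NapNapPair (x * (y * z)) (y * (x * z))
  | nap' (x y z : FreeMagma X) : NapNapPair ((x * y) * z) ((y * x) * z)

/-- The congruence on the free magma generated by `x(yz) = y(xz)` and `(xy)z = (yx)z`. Labels are
allowed to repeat. -/
def napNapCon (X : Type u) : Con (FreeMagma X) := conGen NapNapPair

section Congruence

variable {X : Type u}

theorem napNapCon_nap (x y z : FreeMagma X) : napNapCon X (x * (y * z)) (y * (x * z)) :=
  ConGen.Rel.of _ _ (.nap x y z)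

theorem napNapCon_nap' (x y z : FreeMagma X) : napNapCon X ((x * y) * z) ((y * x) * z) :=
  ConGen.Rel.of _ _ (.nap' x y z)

theorem leaves_perm_of_rel {s t : FreeMagma X} (h : ConGen.Rel NapNapPair s t) :
    (leaves s).Perm (leaves t) := by
  induction h with
  | of s t h =>
    cases h with
    | nap x y z =>
      simp only [leaves_mul, ← List.append_assoc]
      exact List.perm_append_comm.append_right _
    | nap' x y z => exact List.perm_append_comm.append_right _
  | refl x => rfl
  | symm _ ih => exact ih.symm
  | trans _ _ ih ih' => exact ih.trans ih'
  | mul _ _ ih ih' => exact ih.append ih'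

theorem napNapCon_mul_comm_left {s s' : FreeMagma X} (h : ∀ u, napNapCon X (s * u) (s' * u))
    (t u : FreeMagma X) : napNapCon X ((t * s) * u) ((t * s') * u) :=
  (napNapCon X).trans (napNapCon_nap' t s u) <|
    (napNapCon X).trans ((napNapCon X).mul (h t) ((napNapCon X).refl u)) (napNapCon_nap' s' t u)

/-- Two trees are related when they are interchangeable as left factors, modulo the relations
`x(yz) = y(xz)` and `(xy)z = (yx)z`. -/
def leftFactorCon (X : Type u) : Con (FreeMagma X) where
  r s s' := ∀ u, napNapCon X (s * u) (s' * u)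
  iseqv := ⟨fun _ _ => (napNapCon X).refl _, fun h u => (napNapCon X).symm (h u),
    fun h h' u => (napNapCon X).trans (h u) (h' u)⟩
  mul' {_ x y _} h h' u := (napNapCon X).trans
    ((napNapCon X).mul (h y) ((napNapCon X).refl u)) (napNapCon_mul_comm_left h' x u)

/-- Left factors multiply commutatively by `(xy)z = (yx)z`. Associativity comes from the chain
`(ab)c ~ c(ab) ~ a(cb) ~ a(bc)`, whose middle step is `x(yz) = y(xz)`. -/
instance : CommSemigroup (leftFactorCon X).Quotient where
  mul_assoc := by
    rintro ⟨a⟩ ⟨b⟩ ⟨c⟩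
    refine (leftFactorCon X).eq.2 fun u => ?_
    refine (napNapCon X).trans (napNapCon_nap' (a * b) c u) ?_
    refine (napNapCon X).trans
      ((napNapCon X).mul (napNapCon_nap c a b) ((napNapCon X).refl u)) ?_
    exact napNapCon_mul_comm_left (napNapCon_nap' c b) a u
  mul_comm := by
    rintro ⟨a⟩ ⟨b⟩
    exact (leftFactorCon X).eq.2 (napNapCon_nap' a b)

theorem coe_eq_prod_leaves (s : FreeMagma X) :
    (((s : (leftFactorCon X).Quotient)) : WithOne (leftFactorCon X).Quotient) =
      ((leaves s).map fun x =>
        (((FreeMagma.of x : FreeMagma X) : (leftFactorCon X).Quotient) : WithOne _)).prod := by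
  induction s using FreeMagma.recOnMul with
  | ih1 x => simp
  | ih2 s t hs ht => rw [leaves_mul, List.map_append, List.prod_append, ← hs, ← ht]; rfl

/-- As a left factor, a tree only depends on the multiset of its labels. -/
theorem napNapCon_mul_of_perm {s s' : FreeMagma X} (h : (leaves s).Perm (leaves s'))
    (u : FreeMagma X) : napNapCon X (s * u) (s' * u) := by
  have : (s : (leftFactorCon X).Quotient) = s' := by
    rw [← WithOne.coe_inj, coe_eq_prod_leaves, coe_eq_prod_leaves]
    exact (h.map _).prod_eq
  exact (leftFactorCon X).eq.1 this u

theorem napNapCon_foldr_middle (s t : FreeMagma X) (L₁ L₂ : List (FreeMagma X)) :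
    napNapCon X (s * (L₁ ++ L₂).foldr (· * ·) t) ((L₁ ++ s :: L₂).foldr (· * ·) t) := by
  induction L₁ with
  | nil => exact (napNapCon X).refl _
  | cons a L₁ ih =>
    exact (napNapCon X).trans (napNapCon_nap s a _) ((napNapCon X).mul ((napNapCon X).refl a) ih)

theorem napNapCon_foldr_of_perm (t : FreeMagma X) {L L' : List (FreeMagma X)}
    (h : (L.map fun s => (leaves s : Multiset X)).Perm (L'.map fun s => (leaves s : Multiset X))) :
    napNapCon X (L.foldr (· * ·) t) (L'.foldr (· * ·) t) := by
  induction L generalizing L' with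
  | nil =>
    have : L' = [] := by simpa using h.symm
    subst this
    exact (napNapCon X).refl _
  | cons s L ih =>
    obtain ⟨s', hs', hss'⟩ := List.mem_map.1 (h.mem_iff.1 (List.mem_cons_self))
    replace hss' : (leaves s' : Multiset X) = leaves s := hss'
    obtain ⟨L₁, L₂, rfl⟩ := List.append_of_mem hs'
    have h' : (L.map fun s => (leaves s : Multiset X)).Perm
        ((L₁ ++ L₂).map fun s => (leaves s : Multiset X)) := by
      rw [List.map_append, List.map_cons, List.map_cons, hss'] at h
      rw [List.map_append]
      exact (h.trans List.perm_middle).cons_inv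
    refine (napNapCon X).trans
      ((napNapCon X).mul ((napNapCon X).refl s) (ih h')) ?_
    refine (napNapCon X).trans (napNapCon_mul_of_perm (Multiset.coe_eq_coe.1 hss'.symm) _) ?_
    exact napNapCon_foldr_middle s' t L₁ L₂

end Congruence

section Injectivity

variable {B : Type u}

theorem mem_map_leaves_of_toCorolla_eq {s t : LTree B} (h : toCorolla s = toCorolla t)
    {m : Multiset B} (hm : m ∈ (branches s.1).map fun A => (leaves A : Multiset B)) :
    m ∈ (branches t.1).map fun A => (leaves A : Multiset B) := by
  obtain ⟨A, hA, rfl⟩ := List.mem_map.1 hm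
  have hle (x y : B) : treeLe s.1 x y ↔ treeLe t.1 x y := by
    rw [← toCorolla_le, h, toCorolla_le]
  obtain ⟨a, ha⟩ := List.exists_mem_of_ne_nil _ (leaves_ne_nil A)
  have har : a ≠ root t.1 := by
    rintro rfl
    have := (treeLe_iff_mem s.2.1 hA ha).1 ((hle _ (root s.1)).2 (Or.inl rfl))
    exact root_notMem_of_nodup s.2.1 hA this
  obtain ⟨A', hA', ha'⟩ := (mem_leaves_iff.1 (t.2.2 a)).resolve_right har
  refine List.mem_map.2 ⟨A', hA', Multiset.coe_eq_coe.2 ?_⟩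
  rw [List.perm_ext_iff_of_nodup (nodup_of_mem_branches t.2.1 hA') (nodup_of_mem_branches s.2.1 hA)]
  intro b
  rw [← treeLe_iff_mem t.2.1 hA' ha', ← treeLe_iff_mem s.2.1 hA ha, hle]

theorem nodup_map_leaves_branches {t : FreeMagma B} (h : (leaves t).Nodup) :
    ((branches t).map fun A => (leaves A : Multiset B)).Nodup := by
  rw [List.Nodup, List.pairwise_map]
  refine (pairwise_disjoint_branches h).imp fun {A A'} hd he => ?_
  obtain ⟨a, ha⟩ := List.exists_mem_of_ne_nil _ (leaves_ne_nil A)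
  exact hd ha ((Multiset.coe_eq_coe.1 he).mem_iff.1 ha)

/-- Two trees with the same corolla are congruent: they have the same root and the same multisets
of labels of branches. -/
theorem napNapCon_of_toCorolla_eq {s t : LTree B} (h : toCorolla s = toCorolla t) :
    napNapCon B s.1 t.1 := by
  have hroot : root s.1 = root t.1 := by
    rw [← toCorolla_isRoot_iff, ← h, toCorolla_isRoot_iff]
  rw [← foldr_branches s.1, ← foldr_branches t.1, hroot]
  refine napNapCon_foldr_of_perm _ ?_
  rw [List.perm_ext_iff_of_nodup (nodup_map_leaves_branches s.2.1)
    (nodup_map_leaves_branches t.2.1)]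
  exact fun m => ⟨mem_map_leaves_of_toCorolla_eq h, mem_map_leaves_of_toCorolla_eq h.symm⟩

end Injectivity

/-! ### From the free magma to the operadic congruence -/

/-- The operadic congruence which defines the NAPNAP' operad, on labeled trees. -/
abbrev NapNapCongr (A : Type u) [Finite A] (s t : LTree A) : Prop :=
  SetOperad.CongrGen operad.{u} (fun B _ => NapNapRel B) A s t

/-- Two elements of the free magma are images, under a common relabeling map, of two trees with
distinct labels which are identified in the NAPNAP' operad. -/
def LinRel {X : Type u} (x y : FreeMagma X) : Prop :=
  ∃ (A : Type u) (_ : Finite A) (e : A → X) (s t : LTree A),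
    FreeMagma.lift (fun a => FreeMagma.of (e a)) s.1 = x ∧
    FreeMagma.lift (fun a => FreeMagma.of (e a)) t.1 = y ∧ NapNapCongr A s t

section Linear

variable {X : Type u}

theorem lift_map {B C : Type u} (φ : B ≃ C) (F : B → FreeMagma X) (t : LTree C) :
    FreeMagma.lift F (t.map φ).1 = FreeMagma.lift (fun x => F (φ.symm x)) t.1 := by
  simp [LTree.map, lift_lift]

theorem lift_comp {B C : Type u} (F : B → FreeMagma X) (b : B) (G : C → FreeMagma X)
    (s : LTree B) (t : LTree C) (h : FreeMagma.lift G t.1 = F b) :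
    FreeMagma.lift (Sum.elim (fun x : {x // x ≠ b} => F x.1) G) (s.comp b t).1 =
      FreeMagma.lift F s.1 := by
  simp only [LTree.comp, lift_lift]
  congr 2
  funext x
  by_cases hx : x = b
  · subst hx
    simp [lift_lift, h]
  · simp [plug_ne _ hx]

theorem LinRel.of (x : X) : LinRel (FreeMagma.of x) (FreeMagma.of x) :=
  ⟨PUnit, inferInstance, fun _ => x, operad.one, operad.one, rfl, rfl, .refl _⟩

theorem LinRel.symm {x y : FreeMagma X} : LinRel x y → LinRel y x :=
  fun ⟨A, hA, e, s, t, hs, ht, h⟩ => ⟨A, hA, e, t, s, ht, hs, .symm h⟩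

/-- The general step of the proof of `LinRel.lift`: the trees are plugged one after the other at
the labels of `S`. -/
theorem LinRel.lift_of_finset (n : ℕ) {I : Type u} [Finite I] (S : Finset I) (hS : S.card = n)
    {g g' : LTree I} (hg : NapNapCongr I g g') (F F' : I → FreeMagma X)
    (hF : ∀ i ∈ S, LinRel (F i) (F' i))
    (hF' : ∀ i ∉ S, ∃ x, F i = FreeMagma.of x ∧ F' i = FreeMagma.of x) :
    LinRel (FreeMagma.lift F g.1) (FreeMagma.lift F' g'.1) := by
  classical
  induction n generalizing I with
  | zero =>
    obtain rfl := Finset.card_eq_zero.1 hS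
    choose e he he' using fun i => hF' i (Finset.notMem_empty i)
    refine ⟨I, inferInstance, e, g, g', ?_, ?_, hg⟩
    · rw [← funext he]
    · rw [← funext he']
  | succ n ih =>
    obtain ⟨i, hi⟩ := Finset.card_pos.1 (by rw [hS]; exact n.succ_pos)
    obtain ⟨A, hA, e, s, t, hs, ht, hst⟩ := hF i hi
    rw [← lift_comp F i _ g s hs, ← lift_comp F' i _ g' t ht]
    refine ih ((S.subtype (· ≠ i)).map Function.Embedding.inl) ?_
      (SetOperad.CongrGen.comp i hg hst) _ _ ?_ ?_
    · rw [Finset.card_map, Finset.card_subtype, Finset.filter_ne', Finset.card_erase_of_mem hi, hS]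
      rfl
    · rintro (j | a) hj
      · exact hF j.1 (by simpa using hj)
      · simp at hj
    · rintro (j | a) hj
      · refine hF' j.1 fun h => hj ?_
        simpa using h
      · exact ⟨e a, rfl, rfl⟩

/-- The relation `LinRel` is compatible with the substitution of trees for labels. -/
theorem LinRel.lift {I : Type u} [Finite I] {g g' : LTree I} (hg : NapNapCongr I g g')
    {F F' : I → FreeMagma X} (hF : ∀ i, LinRel (F i) (F' i)) :
    LinRel (FreeMagma.lift F g.1) (FreeMagma.lift F' g'.1) := by
  have := Fintype.ofFinite I
  exact LinRel.lift_of_finset _ Finset.univ rfl hg F F' (fun i _ => hF i)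
    fun i hi => (hi (Finset.mem_univ i)).elim

theorem LinRel.mul {w x y z : FreeMagma X} (h : LinRel w x) (h' : LinRel y z) :
    LinRel (w * y) (x * z) :=
  LinRel.lift (g := mu) (g' := mu) (.refl _)
    (F := fun | Two.one => w | Two.two => y) (F' := fun | Two.one => x | Two.two => z)
    (by rintro (_ | _); exacts [h, h'])

theorem LinRel.refl (x : FreeMagma X) : LinRel x x := by
  induction x using FreeMagma.recOnMul with
  | ih1 x => exact LinRel.of x
  | ih2 s t hs ht => exact hs.mul ht

theorem mu_comp_two_mu : (operad.comp mu.{u} Two.two mu).1 =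
    FreeMagma.of (Sum.inl ⟨Two.one, by simp⟩) *
      (FreeMagma.of (Sum.inr Two.one) * FreeMagma.of (Sum.inr Two.two)) := by
  have h : Two.one.{u} ≠ Two.two := by simp
  change FreeMagma.lift _ (FreeMagma.of Two.one * FreeMagma.of Two.two) = _
  simp [plug_ne _ h, mu]

theorem mu_comp_one_mu : (operad.comp mu.{u} Two.one mu).1 =
    (FreeMagma.of (Sum.inr Two.one) * FreeMagma.of (Sum.inr Two.two)) *
      FreeMagma.of (Sum.inl ⟨Two.two, by simp⟩) := by
  have h : Two.two.{u} ≠ Two.one := by simp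
  change FreeMagma.lift _ (FreeMagma.of Two.one * FreeMagma.of Two.two) = _
  simp [plug_ne _ h, mu]

open Classical in
theorem LinRel.of_pair {x y : FreeMagma X} (h : NapNapPair x y) : LinRel x y := by
  cases h with
  | nap x y z =>
    let F : Glue Two.{u} Two.two Two.{u} → FreeMagma X :=
      Sum.elim (fun _ => x) (fun | Two.one => y | Two.two => z)
    have := LinRel.lift (X := X) (.of NapNapRel.nap) (F := F) (F' := F) fun i => .refl _
    rw [show ∀ φ : Glue Two.{u} Two.two Two.{u} ≃ _, FreeMagma.lift F (operad.map φ _).1 = _ from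
      fun φ => lift_map φ F _, mu_comp_two_mu] at this
    simpa [F, Equiv.swap_apply_of_ne_of_ne] using this
  | nap' x y z =>
    let F : Glue Two.{u} Two.one Two.{u} → FreeMagma X :=
      Sum.elim (fun _ => z) (fun | Two.one => x | Two.two => y)
    have := LinRel.lift (X := X) (.of NapNapRel.nap') (F := F) (F' := F) fun i => .refl _
    rw [show ∀ φ : Glue Two.{u} Two.one Two.{u} ≃ _, FreeMagma.lift F (operad.map φ _).1 = _ from
      fun φ => lift_map φ F _, mu_comp_one_mu] at this
    simpa [F, Equiv.swap_apply_of_ne_of_ne] using this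

theorem injective_of_nodup_leaves_lift {A : Type u} {e : A → X} (s : LTree A)
    (h : (leaves (FreeMagma.lift (fun a => FreeMagma.of (e a)) s.1)).Nodup) :
    Function.Injective e := by
  rw [leaves_lift_of] at h
  exact fun a b hab => List.inj_on_of_nodup_map h (s.2.2 a) (s.2.2 b) hab

theorem range_eq_leaves_lift {A : Type u} (e : A → X) (s : LTree A) :
    Set.range e = {x | x ∈ leaves (FreeMagma.lift (fun a => FreeMagma.of (e a)) s.1)} := by
  ext x
  simp [leaves_lift_of, s.2.2]

theorem lift_of_injective {A : Type u} {e : A → X} (he : Function.Injective e) {s t : LTree A}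
    (h : FreeMagma.lift (fun a => FreeMagma.of (e a)) s.1 =
      FreeMagma.lift (fun a => FreeMagma.of (e a)) t.1) : s = t := by
  have : Nonempty A := ⟨root s.1⟩
  have h' := congrArg (FreeMagma.lift fun x => FreeMagma.of (Function.invFun e x)) h
  simp only [lift_lift, FreeMagma.lift_of, Function.leftInverse_invFun he _, lift_of_eq] at h'
  exact Subtype.ext h'

/-- When the middle term has distinct labels, the two label sets are canonically identified, since
both are identified with the set of labels of this term. -/
theorem LinRel.trans {x y z : FreeMagma X} (hy : (leaves y).Nodup) (h : LinRel x y)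
    (h' : LinRel y z) : LinRel x z := by
  obtain ⟨A, hA, e, s, s', hs, hs', hss'⟩ := h
  obtain ⟨A', hA', e', t, t', ht, ht', htt'⟩ := h'
  have he : Function.Injective e := injective_of_nodup_leaves_lift s' (hs' ▸ hy)
  have he' : Function.Injective e' := injective_of_nodup_leaves_lift t (ht ▸ hy)
  have hr : Set.range e = Set.range e' := by
    rw [range_eq_leaves_lift e s', range_eq_leaves_lift e' t, hs', ht]
  let φ : A ≃ A' := (Equiv.ofInjective e he).trans
    ((Equiv.setCongr hr).trans (Equiv.ofInjective e' he').symm)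
  have hφ (a : A') : e (φ.symm a) = e' a := by
    simp [φ, Equiv.apply_ofInjective_symm]
  have hmap (t : LTree A') : FreeMagma.lift (fun a => FreeMagma.of (e a)) (t.map φ).1 =
      FreeMagma.lift (fun a => FreeMagma.of (e' a)) t.1 := by
    simp only [lift_map, hφ]
  have hs't : s' = t.map φ := lift_of_injective he (by rw [hs', hmap, ht])
  exact ⟨A, hA, e, s, t'.map φ, hs, by rw [hmap, ht'],
    .trans hss' (hs't ▸ SetOperad.CongrGen.map φ htt')⟩

theorem LinRel.of_rel {x y : FreeMagma X} (h : ConGen.Rel NapNapPair x y)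
    (hx : (leaves x).Nodup) : LinRel x y := by
  induction h with
  | of x y h => exact .of_pair h
  | refl x => exact .refl x
  | symm h ih => exact (ih ((leaves_perm_of_rel h).nodup_iff.2 hx)).symm
  | trans h _ ih ih' =>
    have hy := (leaves_perm_of_rel h).nodup_iff.1 hx
    exact (ih hx).trans hy (ih' hy)
  | mul _ _ ih ih' =>
    rw [leaves_mul, List.nodup_append'] at hx
    exact (ih hx.1).mul (ih' hx.2.1)

/-- On trees with distinct labels, the congruence of the free magma refines the operadic one. -/
theorem napNapCongr_of_napNapCon {B : Type u} [Finite B] {s t : LTree B}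
    (h : napNapCon B s.1 t.1) : NapNapCongr B s t := by
  obtain ⟨A, hA, e, a, a', ha, ha', haa'⟩ := LinRel.of_rel h s.2.1
  have he : Function.Bijective e := by
    refine ⟨injective_of_nodup_leaves_lift a (ha ▸ s.2.1), fun x => ?_⟩
    have hx : x ∈ Set.range e := by
      rw [range_eq_leaves_lift e a, ha]
      exact s.2.2 x
    exact hx
  let φ := Equiv.ofBijective e he
  have hs : a.map φ.symm = s := Subtype.ext ha
  have ht : a'.map φ.symm = t := Subtype.ext ha'
  rw [← hs, ← ht]
  exact SetOperad.CongrGen.map φ.symm haa'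

end Linear

end Magmatic

/-! ### Set operads along surjective morphisms -/

/-- The operad axioms are equations between composites, so they pass from an operad to the image of
a morphism. -/
theorem OperadData.IsOperad.of_surjective {P Q : OperadData.{u}} (hP : P.IsOperad)
    (f : (B : Type u) → [Finite B] → P.obj B → Q.obj B)
    (hf : ∀ (B : Type u) [Finite B], Function.Surjective (f B))
    (hmap : ∀ {B C : Type u} [Finite B] [Finite C] (φ : B ≃ C) (α : P.obj C),
      f B (P.map φ α) = Q.map φ (f C α))
    (hone : f PUnit.{u + 1} P.one = Q.one)
    (hcomp : ∀ {B C : Type u} [Finite B] [Finite C] (α : P.obj B) (b : B) (β : P.obj C),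
      f (Glue B b C) (P.comp α b β) = Q.comp (f B α) b (f C β)) : Q.IsOperad where
  positive B _ _ := ⟨fun x => by
    obtain ⟨y, -⟩ := hf B x
    exact (hP.positive B).false y⟩
  map_comp φ ψ b α β := by
    obtain ⟨α, rfl⟩ := hf _ α
    obtain ⟨β, rfl⟩ := hf _ β
    rw [← hcomp, ← hmap, hP.map_comp, hcomp, hmap, hmap]
  comp_seq b c α β γ := by
    obtain ⟨α, rfl⟩ := hf _ α
    obtain ⟨β, rfl⟩ := hf _ β
    obtain ⟨γ, rfl⟩ := hf _ γ
    simp only [← hcomp, ← hmap, hP.comp_seq]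
  comp_par b b' h α β γ := by
    obtain ⟨α, rfl⟩ := hf _ α
    obtain ⟨β, rfl⟩ := hf _ β
    obtain ⟨γ, rfl⟩ := hf _ γ
    simp only [← hcomp, ← hmap]
    rw [hP.comp_par]
  one_comp α := by
    obtain ⟨α, rfl⟩ := hf _ α
    simp only [← hone, ← hcomp, ← hmap, hP.one_comp]
  comp_one b α := by
    obtain ⟨α, rfl⟩ := hf _ α
    simp only [← hone, ← hcomp, ← hmap, hP.comp_one]

namespace Magmatic

/-! ### The isomorphism with the NAPNAP' operad -/

theorem treeLe_iff_of_napNapPair {X : Type u} {s t : FreeMagma X} (h : NapNapPair s t) (a b : X) :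
    treeLe s a b ↔ treeLe t a b := by
  cases h with
  | nap x y z => simp only [treeLe_mul, or_left_comm]
  | nap' x y z => simp only [treeLe_mul, leaves_mul, List.mem_append, or_comm]

theorem napNapPair_of_napNapRel {B : Type u} [Finite B] {s t : LTree B} (h : NapNapRel B s t) :
    NapNapPair s.1 t.1 := by
  classical
  cases h with
  | nap =>
    change NapNapPair _ (FreeMagma.lift _ _)
    rw [mu_comp_two_mu]
    simpa [Equiv.swap_apply_of_ne_of_ne] using NapNapPair.nap _ _ _
  | nap' =>
    change NapNapPair _ (FreeMagma.lift _ _)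
    rw [mu_comp_one_mu]
    simpa [Equiv.swap_apply_of_ne_of_ne] using NapNapPair.nap' _ _ _

theorem toCorolla_one : toCorolla operad.one = Corolla.one :=
  Corolla.ext fun _ _ => iff_of_true (Or.inl rfl) trivial

theorem toCorolla_eq_of_napNapCongr {B : Type u} [Finite B] {s t : LTree B}
    (h : NapNapCongr B s t) : toCorolla s = toCorolla t := by
  refine SetOperad.CongrGen.rec (P := operad.{u})
    (motive := fun B _ (s t : LTree B) _ => toCorolla s = toCorolla t)
    ?_ ?_ ?_ ?_ ?_ ?_ h
  · exact fun h => Corolla.ext (treeLe_iff_of_napNapPair (napNapPair_of_napNapRel h))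
  · exact fun _ => rfl
  · exact fun _ ih => ih.symm
  · exact fun _ _ ih ih' => ih.trans ih'
  · intro B C _ _ φ x y _ ih
    exact (toCorolla_map φ x).trans ((congrArg _ ih).trans (toCorolla_map φ y).symm)
  · intro B C _ _ b x x' y y' _ _ ih ih'
    exact (toCorolla_comp x b y).trans
      ((congrArg₂ (fun β γ => Corolla.comp β b γ) ih ih').trans (toCorolla_comp x' b y').symm)

theorem napNapCongr_iff_toCorolla_eq {B : Type u} [Finite B] {s t : LTree B} :
    NapNapCongr B s t ↔ toCorolla s = toCorolla t :=
  ⟨toCorolla_eq_of_napNapCongr, fun h => napNapCongr_of_napNapCon (napNapCon_of_toCorolla_eq h)⟩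

theorem corollaData_isOperad : corollaData.{u}.IsOperad :=
  operad.{u}.isOperad.of_surjective (fun _ _ => toCorolla) (fun _ _ => toCorolla_surjective)
    toCorolla_map toCorolla_one toCorolla_comp

/-- The bijection from NAPNAP' to corollas induced by the corolla of a tree. -/
noncomputable def napNapEquivCorolla (B : Type u) [Finite B] :
    napNapOperad.{u}.obj B ≃ Corolla B :=
  Equiv.ofBijective (Quotient.lift toCorolla fun _ _ => toCorolla_eq_of_napNapCongr) <| by
    constructor
    · rintro ⟨s⟩ ⟨t⟩ h
      exact Quotient.sound (napNapCongr_iff_toCorolla_eq.2 h)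
    · intro β
      obtain ⟨t, rfl⟩ := toCorolla_surjective β
      exact ⟨Quotient.mk _ t, rfl⟩

theorem napNapEquivCorolla_map {B C : Type u} [Finite B] [Finite C] (φ : B ≃ C)
    (α : napNapOperad.obj C) :
    napNapEquivCorolla B (napNapOperad.map φ α) = (napNapEquivCorolla C α).map φ := by
  rcases α with ⟨t⟩
  exact toCorolla_map φ t

theorem napNapEquivCorolla_comp {B C : Type u} [Finite B] [Finite C] (α : napNapOperad.obj B)
    (b : B) (β : napNapOperad.obj C) :
    napNapEquivCorolla (Glue B b C) (napNapOperad.comp α b β) =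
      (napNapEquivCorolla B α).comp b (napNapEquivCorolla C β) := by
  rcases α with ⟨s⟩
  rcases β with ⟨t⟩
  exact toCorolla_comp s b t

theorem napNapEquivCorolla_symm_map {B C : Type u} [Finite B] [Finite C] (φ : B ≃ C)
    (α : Corolla C) :
    (napNapEquivCorolla B).symm (α.map φ) =
      napNapOperad.map φ ((napNapEquivCorolla C).symm α) := by
  rw [Equiv.symm_apply_eq, napNapEquivCorolla_map, Equiv.apply_symm_apply]

theorem napNapEquivCorolla_symm_one :
    (napNapEquivCorolla PUnit.{u + 1}).symm Corolla.one = napNapOperad.one := by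
  rw [Equiv.symm_apply_eq]
  exact toCorolla_one.symm

theorem napNapEquivCorolla_symm_comp {B C : Type u} [Finite B] [Finite C] (α : Corolla B)
    (b : B) (β : Corolla C) :
    (napNapEquivCorolla (Glue B b C)).symm (α.comp b β) =
      napNapOperad.comp ((napNapEquivCorolla B).symm α) b ((napNapEquivCorolla C).symm β) := by
  rw [Equiv.symm_apply_eq, napNapEquivCorolla_comp, Equiv.apply_symm_apply,
    Equiv.apply_symm_apply]

end Magmatic

open Magmatic in
theorem mainTheorem5 :
    ∃ h : corollaData.{u}.IsOperad,
      Nonempty (SetOperad.Iso (SetOperad.mk corollaData.{u} h) napNapOperad.{u}) := by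
  exact ⟨corollaData_isOperad, ⟨{
    equiv := fun B _ => (napNapEquivCorolla B).symm
    map_equiv := napNapEquivCorolla_symm_map
    equiv_one := napNapEquivCorolla_symm_one
    equiv_comp := napNapEquivCorolla_symm_comp }⟩⟩
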